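/- Let $\mathcal H$ be a complex Hilbert space with an orthonormal basis $(e_n)_{n\in\mathbb Z}$, let $(\omega_n)_{n\in\mathbb Z}$ be a bounded sequence of positive numbers, and let $S$ be the bilateral weighted shift, i.e. the bounded linear operator on $\mathcal H$ with $Se_n=\omega_n e_{n+1}$ for all $n\in\mathbb Z$. Put $\beta_n=\omega_0\cdots\omega_{n-1}$ for $n>0$, $\beta_0=1$, $\beta_n=1/(\omega_n\cdots\omega_{-1})$ for $n<0$, and $$r^-(S)=\lim_{n\to\infty}\Big[\sup_{k>0}\tfrac{\beta_{-k}}{\beta_{-n-k}}\Big]^{1/n},\quad r^+(S)=\lim_{n\to\infty}\Big[\sup_{k\ge0}\tfrac{\beta_{n+k}}{\beta_k}\Big]^{1/n},$$ $$r_1^-(S)=\lim_{n\to\infty}\Big[\inf_{k>0}\tfrac{\beta_{-k}}{\beta_{-n-k}}\Big]^{1/n},\quad r_1^+(S)=\lim_{n\to\infty}\Big[\inf_{k\ge0}\tfrac{\beta_{n+k}}{\beta_k}\Big]^{1/n},$$ $$r_2^-(S)=\liminf_{n\to\infty}\Big[\tfrac1{\beta_{-n}}\Big]^{1/n},\quad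 r_2^+(S)=\liminf_{n\to\infty}\beta_n^{1/n},\quad r_3^-(S)=\limsup_{n\to\infty}\Big[\tfrac1{\beta_{-n}}\Big]^{1/n},\quad r_3^+(S)=\limsup_{n\to\infty}\beta_n^{1/n}.$$ Let $r(\cdot)$ denote the spectral radius and $q(S)=\min\{|\lambda|:\lambda\in\sigma(S)\}$. For an open set $U\subset\mathbb C$ let $\mathcal O(U,\mathcal H)$ be the space of analytic $\mathcal H$-valued functions on $U$ with the topology of uniform convergence on compact subsets of $U$, and for a bounded operator $T$ on $\mathcal H$ let $T_U$ be the map on $\mathcal O(U,\mathcal H)$ given by $(T_Uf)(\lambda)=(T-\lambda)f(\lambda)$. The operator $T$ possesses Bishop's property $(\beta)$ if $T_U$ is injective with closed range for every open $U\subset\mathbb C$; it possesses $(\beta)$ at $\lambda_0\in\mathbb C$ if there is an open neighbourhood $V$ of $\lambda_0$ such that $T_U$ is injective with closed range for every open $U\subset V$. Let $\sigma_\beta(T)$ be the set of all $\lambda\in\mathbb C$ at which $T$ fails to possess $(\beta)$. **Theorem.** Assume that $$q(S)=r_1^-(S)=r_2^-(S)=r_3^-(S)=r^-(S)\quad\text{and}\quad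 r_1^+(S)=r_2^+(S)=r_3^+(S)=r^+(S)=r(S).$$ (a) If $S$ is not invertible, then either $S$ possesses Bishop's property $(\beta)$ or $\sigma_\beta(S)=\{\lambda\in\mathbb C:|\lambda|=r(S)\}$. (b) If $S$ is invertible, then either $S$ possesses Bishop's property $(\beta)$ or $\sigma_\beta(S)$ equals one of the circles $\{\lambda\in\mathbb C:|\lambda|=1/r(S^{-1})\}$ and $\{\lambda\in\mathbb C:|\lambda|=r(S)\}$, or the union of both of them. -/

import Mathlib

open Filter Topology

namespace WeightedShift

noncomputable section

/-! ### Bishop's property (β) -/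

section Bishop

variable {H : Type*} [NormedAddCommGroup H] [InnerProductSpace ℂ H]

/-- The space `O(U, H)` of analytic `H`-valued functions on `U ⊆ ℂ`, as a subspace of the space
`C(U, H)` of continuous functions. It carries the induced topology; the topology of `C(U, H)` is
the compact-open one, that is, the topology of uniform convergence on compact subsets of `U`. -/
def holo (U : Set ℂ) : Submodule ℂ C(U, H) where
  carrier := {f | ∃ F : ℂ → H, AnalyticOnNhd ℂ F U ∧ ∀ z : U, f z = F z}
  add_mem' := by
    rintro f g ⟨F, hF, hf⟩ ⟨G, hG, hg⟩
    exact ⟨F + G, hF.add hG, fun z => by simp [hf, hg]⟩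
  zero_mem' := ⟨0, fun _ _ => analyticAt_const, fun _ => rfl⟩
  smul_mem' := by
    rintro c f ⟨F, hF, hf⟩
    exact ⟨c • F, fun z hz => (hF z hz).const_smul, fun z => by simp [hf]⟩

/-- The map `T_U` on `O(U, H)`, given by `(T_U f)(z) = (T - z) f(z)`. -/
def bishopMap (T : H →L[ℂ] H) (U : Set ℂ) : holo (H := H) U →ₗ[ℂ] holo (H := H) U where
  toFun f := ⟨⟨fun z => T (f.1 z) - (z : ℂ) • f.1 z, by fun_prop⟩, by
    obtain ⟨F, hF, hf⟩ := f.2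
    refine ⟨fun z => T (F z) - z • F z, fun z hz => ?_, fun z => by simp [hf]⟩
    exact ((T.analyticAt _).comp (hF z hz)).sub (analyticAt_id.smul (hF z hz))⟩
  map_add' f g := by
    ext z
    simp only [Submodule.coe_add, ContinuousMap.add_apply, ContinuousMap.coe_mk, map_add, smul_add]
    abel
  map_smul' c f := by
    ext z
    simp only [Submodule.coe_smul, ContinuousMap.smul_apply, ContinuousMap.coe_mk, map_smul,
      RingHom.id_apply, smul_sub, smul_comm c]

/-- Bishop's property (β): for every open `U ⊆ ℂ`, the map `T_U` is injective and has closed range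
in `O(U, H)`. -/
def HasBishop (T : H →L[ℂ] H) : Prop :=
  ∀ U : Set ℂ, IsOpen U →
    Function.Injective (bishopMap T U) ∧ IsClosed (Set.range (bishopMap T U))

/-- Bishop's property (β) at the point `z₀`. -/
def HasBishopAt (T : H →L[ℂ] H) (z₀ : ℂ) : Prop :=
  ∃ V : Set ℂ, IsOpen V ∧ z₀ ∈ V ∧ ∀ U : Set ℂ, IsOpen U → U ⊆ V →
    Function.Injective (bishopMap T U) ∧ IsClosed (Set.range (bishopMap T U))

/-- `σ_β(T)`: the set of points at which `T` fails to possess Bishop's property (β). -/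
def sigmaBeta (T : H →L[ℂ] H) : Set ℂ := {z | ¬ HasBishopAt T z}

/-- The spectral radius `r(T)` as a real number. -/
def specRadius (T : H →L[ℂ] H) : ℝ := (spectralRadius ℂ T).toReal

/-- `q(T) = min {|z| : z ∈ σ(T)}`. -/
def minModulus (T : H →L[ℂ] H) : ℝ := sInf ((fun z : ℂ => ‖z‖) '' spectrum ℂ T)

end Bishop

/-! ### Bilateral weighted shifts and their radii -/

/-- `S` is the bilateral weighted shift with positive weights `ω` along the orthonormal basis `e`.
(The weights are bounded because `S` is, see `IsBilateralShift.bddAbove`.) -/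
structure IsBilateralShift {H : Type*} [NormedAddCommGroup H] [InnerProductSpace ℂ H]
    (e : HilbertBasis ℤ ℂ H) (ω : ℤ → ℝ) (S : H →L[ℂ] H) : Prop where
  pos : ∀ n, 0 < ω n
  apply_basis : ∀ n, S (e n) = (ω n : ℂ) • e (n + 1)

/-- `β_n = ω_0 ⋯ ω_{n-1}` for `n ≥ 0` (so `β_0 = 1`), and `β_n = 1 / (ω_n ⋯ ω_{-1})` for
`n < 0`. -/
def beta (ω : ℤ → ℝ) (n : ℤ) : ℝ :=
  if 0 ≤ n then ∏ i ∈ Finset.Ico 0 n, ω i else 1 / ∏ i ∈ Finset.Ico n 0, ω i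

/-- `r^-(S) = lim_n [sup_{k>0} β_{-k} / β_{-n-k}]^{1/n}`; here `k > 0` is written as `k + 1`. -/
def rMinus (ω : ℤ → ℝ) : ℝ :=
  limUnder atTop fun n : ℕ =>
    (⨆ k : ℕ, beta ω (-(k + 1)) / beta ω (-n - (k + 1))) ^ (1 / (n : ℝ))

/-- `r^+(S) = lim_n [sup_{k≥0} β_{n+k} / β_k]^{1/n}`. -/
def rPlus (ω : ℤ → ℝ) : ℝ :=
  limUnder atTop fun n : ℕ => (⨆ k : ℕ, beta ω (n + k) / beta ω k) ^ (1 / (n : ℝ))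

/-- `r_1^-(S) = lim_n [inf_{k>0} β_{-k} / β_{-n-k}]^{1/n}`; here `k > 0` is written as `k + 1`. -/
def rMinus₁ (ω : ℤ → ℝ) : ℝ :=
  limUnder atTop fun n : ℕ =>
    (⨅ k : ℕ, beta ω (-(k + 1)) / beta ω (-n - (k + 1))) ^ (1 / (n : ℝ))

/-- `r_1^+(S) = lim_n [inf_{k≥0} β_{n+k} / β_k]^{1/n}`. -/
def rPlus₁ (ω : ℤ → ℝ) : ℝ :=
  limUnder atTop fun n : ℕ => (⨅ k : ℕ, beta ω (n + k) / beta ω k) ^ (1 / (n : ℝ))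

/-- `r_2^-(S) = liminf_n [1 / β_{-n}]^{1/n}`. -/
def rMinus₂ (ω : ℤ → ℝ) : ℝ :=
  liminf (fun n : ℕ => (1 / beta ω (-n)) ^ (1 / (n : ℝ))) atTop

/-- `r_2^+(S) = liminf_n [β_n]^{1/n}`. -/
def rPlus₂ (ω : ℤ → ℝ) : ℝ :=
  liminf (fun n : ℕ => (beta ω n) ^ (1 / (n : ℝ))) atTop

/-- `r_3^-(S) = limsup_n [1 / β_{-n}]^{1/n}`. -/
def rMinus₃ (ω : ℤ → ℝ) : ℝ :=
  limsup (fun n : ℕ => (1 / beta ω (-n)) ^ (1 / (n : ℝ))) atTop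

/-- `r_3^+(S) = limsup_n [β_n]^{1/n}`. -/
def rPlus₃ (ω : ℤ → ℝ) : ℝ :=
  limsup (fun n : ℕ => (beta ω n) ^ (1 / (n : ℝ))) atTop

/-! ### The limits in the definitions of the radii exist -/

theorem IsBilateralShift.bddAbove {H : Type*} [NormedAddCommGroup H] [InnerProductSpace ℂ H]
    {e : HilbertBasis ℤ ℂ H} {ω : ℤ → ℝ} {S : H →L[ℂ] H} (hS : IsBilateralShift e ω S) :
    BddAbove (Set.range ω) := by
  refine ⟨‖S‖, ?_⟩
  rintro _ ⟨n, rfl⟩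
  have h := S.le_opNorm (e n)
  rw [hS.apply_basis, norm_smul, e.orthonormal.1, e.orthonormal.1] at h
  simpa [abs_of_pos (hS.pos n)] using h

theorem exists_tendsto_of_submul {v : ℕ → ℝ} (hv : ∀ n, 0 < v n)
    (h : ∀ m n, v (m + n) ≤ v m * v n) :
    ∃ L, Tendsto (fun n : ℕ => v n ^ (1 / (n : ℝ))) atTop (𝓝 L) := by
  have hs : Subadditive fun n => Real.log (v n) := fun m n => by
    simp only
    rw [← Real.log_mul (hv m).ne' (hv n).ne']
    exact Real.log_le_log (hv _) (h m n)
  have hrw : ∀ n : ℕ, v n ^ (1 / (n : ℝ)) = Real.exp (Real.log (v n) / n) := fun n => by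
    rw [Real.rpow_def_of_pos (hv n), mul_one_div]
  have hb : BddBelow ((fun n : ℕ => v n ^ (1 / (n : ℝ))) '' Set.Ici 1) :=
    ⟨0, by rintro _ ⟨n, -, rfl⟩; exact Real.rpow_nonneg (hv n).le _⟩
  refine ⟨sInf ((fun n : ℕ => v n ^ (1 / (n : ℝ))) '' Set.Ici 1), tendsto_order.2 ⟨fun l hl => ?_,
    fun L hL => ?_⟩⟩
  · exact eventually_atTop.2 ⟨1, fun n hn => hl.trans_le (csInf_le hb ⟨n, hn, rfl⟩)⟩
  · obtain ⟨_, ⟨n, hn, rfl⟩, hx⟩ := exists_lt_of_csInf_lt (by simp) hL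
    have hL0 : 0 < L := (Real.rpow_pos_of_pos (hv n) _).trans hx
    simp only [hrw] at hx ⊢
    rw [← Real.lt_log_iff_exp_lt hL0] at hx
    refine (hs.eventually_div_lt_of_div_lt (Nat.one_le_iff_ne_zero.1 hn) hx).mono fun p hp => ?_
    exact (Real.lt_log_iff_exp_lt hL0).1 hp

theorem exists_tendsto_iSup {w : ℕ → ℝ} (hw : ∀ n, 0 < w n) (hb : BddAbove (Set.range w)) :
    ∃ L, Tendsto (fun n : ℕ => (⨆ k : ℕ, ∏ i ∈ Finset.range n, w (k + i)) ^ (1 / (n : ℝ)))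
      atTop (𝓝 L) := by
  obtain ⟨C, hC⟩ := hb
  have hC' : ∀ n, w n ≤ C := fun n => hC ⟨n, rfl⟩
  have hbd : ∀ n, BddAbove (Set.range fun k : ℕ => ∏ i ∈ Finset.range n, w (k + i)) := fun n => by
    refine ⟨C ^ n, ?_⟩
    rintro _ ⟨k, rfl⟩
    simpa using Finset.prod_le_prod (s := Finset.range n) (fun i _ => (hw (k + i)).le)
      (fun i _ => hC' (k + i))
  have hpos : ∀ n k, 0 < ∏ i ∈ Finset.range n, w (k + i) := fun n k =>
    Finset.prod_pos fun i _ => hw _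
  refine exists_tendsto_of_submul (fun n => (hpos n 0).trans_le (le_ciSup (hbd n) 0))
    fun m n => ciSup_le fun k => ?_
  rw [Finset.prod_range_add]
  refine mul_le_mul (le_ciSup (hbd m) k) ?_ (Finset.prod_pos fun i _ => hw _).le
    ((hpos m 0).trans_le (le_ciSup (hbd m) 0)).le
  simpa only [add_assoc] using le_ciSup (hbd n) (k + m)

theorem exists_tendsto_iInf {w : ℕ → ℝ} (hw : ∀ n, 0 < w n) (hb : BddAbove (Set.range w)) :
    ∃ L, Tendsto (fun n : ℕ => (⨅ k : ℕ, ∏ i ∈ Finset.range n, w (k + i)) ^ (1 / (n : ℝ)))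
      atTop (𝓝 L) := by
  obtain ⟨C, hC⟩ := hb
  have hC' : ∀ n, w n ≤ C := fun n => hC ⟨n, rfl⟩
  have hC0 : 0 < C := (hw 0).trans_le (hC' 0)
  have hpos : ∀ n k, 0 < ∏ i ∈ Finset.range n, w (k + i) := fun n k =>
    Finset.prod_pos fun i _ => hw _
  have hle : ∀ n k, ∏ i ∈ Finset.range n, w (k + i) ≤ C ^ n := fun n k => by
    simpa using Finset.prod_le_prod (s := Finset.range n) (fun i _ => (hw (k + i)).le)
      (fun i _ => hC' (k + i))
  have hbd : ∀ n, BddBelow (Set.range fun k : ℕ => ∏ i ∈ Finset.range n, w (k + i)) := fun n =>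
    ⟨0, by rintro _ ⟨k, rfl⟩; exact (hpos n k).le⟩
  by_cases hc : ∃ c, 0 < c ∧ ∀ n, c ≤ w n
  · obtain ⟨c, hc, hcw⟩ := hc
    have hI : ∀ n, 0 < ⨅ k : ℕ, ∏ i ∈ Finset.range n, w (k + i) := fun n =>
      (pow_pos hc n).trans_le <| le_ciInf fun k => by
        simpa using Finset.prod_le_prod (s := Finset.range n) (fun i _ => hc.le)
          (fun i _ => hcw (k + i))
    obtain ⟨L, hL⟩ := exists_tendsto_of_submul
      (v := fun n => (⨅ k : ℕ, ∏ i ∈ Finset.range n, w (k + i))⁻¹)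
      (fun n => inv_pos.2 (hI n)) fun m n => by
        rw [← mul_inv]
        refine inv_anti₀ (mul_pos (hI m) (hI n)) (le_ciInf fun k => ?_)
        rw [Finset.prod_range_add]
        refine mul_le_mul (ciInf_le (hbd m) k) ?_ (hI n).le (hpos m k).le
        simpa only [add_assoc] using ciInf_le (hbd n) (k + m)
    have hL0 : L ≠ 0 := by
      refine ((inv_pos.2 hC0).trans_le (ge_of_tendsto hL ?_)).ne'
      filter_upwards [eventually_ge_atTop 1] with n hn
      have hn' : (n : ℝ) ≠ 0 := by positivity
      rw [Real.inv_rpow (hI n).le]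
      refine inv_anti₀ (Real.rpow_pos_of_pos (hI n) _) ?_
      calc _ ≤ (C ^ n) ^ (1 / (n : ℝ)) :=
            Real.rpow_le_rpow (hI n).le ((ciInf_le (hbd n) 0).trans (hle n 0)) (by positivity)
        _ = C := by
            rw [← Real.rpow_natCast, ← Real.rpow_mul hC0.le, mul_one_div_cancel hn', Real.rpow_one]
    refine ⟨L⁻¹, (hL.inv₀ hL0).congr fun n => ?_⟩
    rw [Real.inv_rpow (hI n).le, inv_inv]
  · push Not at hc
    refine ⟨0, tendsto_const_nhds.congr' ?_⟩
    filter_upwards [eventually_ge_atTop 1] with n hn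
    have hz : (⨅ k : ℕ, ∏ i ∈ Finset.range n, w (k + i)) = 0 := by
      refine le_antisymm (le_of_forall_pos_le_add fun ε hε => ?_)
        (le_ciInf fun k => (hpos n k).le)
      obtain ⟨k, hk⟩ := hc (ε / C ^ (n - 1)) (by positivity)
      refine (ciInf_le (hbd n) k).trans ?_
      obtain ⟨m, rfl⟩ := Nat.exists_eq_add_of_le' hn
      rw [Finset.prod_range_succ', zero_add]
      have h1 : ∏ i ∈ Finset.range m, w (k + (i + 1)) ≤ C ^ m := by
        simpa using Finset.prod_le_prod (s := Finset.range m) (fun i _ => (hw (k + (i + 1))).le)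
          (fun i _ => hC' (k + (i + 1)))
      calc _ ≤ C ^ m * (ε / C ^ m) := by
            refine mul_le_mul h1 ?_ (hw _).le (by positivity)
            simpa using hk.le
        _ = ε := by field_simp
    rw [hz, Real.zero_rpow]
    positivity

theorem beta_pos {ω : ℤ → ℝ} (hω : ∀ n, 0 < ω n) (n : ℤ) : 0 < beta ω n := by
  unfold beta
  split_ifs
  · exact Finset.prod_pos fun i _ => hω i
  · exact one_div_pos.2 (Finset.prod_pos fun i _ => hω i)

theorem beta_succ {ω : ℤ → ℝ} (hω : ∀ n, 0 < ω n) (n : ℤ) :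
    beta ω (n + 1) = beta ω n * ω n := by
  unfold beta
  rcases lt_trichotomy n (-1) with h | h | h
  · have h1 : Finset.Ico n 0 = insert n (Finset.Ico (n + 1) 0) := by ext; simp; lia
    rw [if_neg (by lia), if_neg (by lia), h1, Finset.prod_insert (by simp)]
    have := (hω n).ne'
    have : ∏ i ∈ Finset.Ico (n + 1) 0, ω i ≠ 0 := (Finset.prod_pos fun i _ => hω i).ne'
    field_simp
  · subst h
    have h1 : Finset.Ico (-1 : ℤ) 0 = {-1} := rfl
    have := (hω (-1)).ne'
    simp [h1, this]
  · rw [if_pos (by lia), if_pos (by lia)]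
    have : Finset.Ico 0 (n + 1) = insert n (Finset.Ico 0 n) := by ext; simp; lia
    rw [this, Finset.prod_insert (by simp), mul_comm]

theorem beta_add_div {ω : ℤ → ℝ} (hω : ∀ n, 0 < ω n) (m : ℤ) (n : ℕ) :
    beta ω (m + n) / beta ω m = ∏ i ∈ Finset.range n, ω (m + i) := by
  rw [div_eq_iff (beta_pos hω m).ne']
  induction n with
  | zero => simp
  | succ n ih =>
    rw [Nat.cast_succ, ← add_assoc, beta_succ hω, ih, Finset.prod_range_succ]
    ring

theorem beta_neg_div {ω : ℤ → ℝ} (hω : ∀ n, 0 < ω n) (n k : ℕ) :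
    beta ω (-(k + 1)) / beta ω (-n - (k + 1)) =
      ∏ i ∈ Finset.range n, ω (-((k + i : ℕ) : ℤ) - 2) := by
  have h := beta_add_div hω (-n - (k + 1)) n
  rw [show (-n - (k + 1) + n : ℤ) = -(k + 1) by ring] at h
  rw [h, ← Finset.prod_range_reflect]
  refine Finset.prod_congr rfl fun i hi => congrArg ω ?_
  have := Finset.mem_range.1 hi
  lia

section

variable {H : Type*} [NormedAddCommGroup H] [InnerProductSpace ℂ H]
  {e : HilbertBasis ℤ ℂ H} {ω : ℤ → ℝ} {S : H →L[ℂ] H}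

theorem IsBilateralShift.tendsto_rPlus (hS : IsBilateralShift e ω S) :
    Tendsto (fun n : ℕ => (⨆ k : ℕ, beta ω (n + k) / beta ω k) ^ (1 / (n : ℝ))) atTop
      (𝓝 (rPlus ω)) := by
  refine tendsto_nhds_limUnder ?_
  have h : ∀ n k : ℕ, beta ω (n + k) / beta ω k = ∏ i ∈ Finset.range n, ω ((k + i : ℕ) : ℤ) :=
    fun n k => by rw [add_comm, beta_add_div hS.pos]; simp
  simp only [h]
  exact exists_tendsto_iSup (w := fun n : ℕ => ω n) (fun n => hS.pos n)
    (hS.bddAbove.mono (Set.range_comp_subset_range _ _))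

theorem IsBilateralShift.tendsto_rPlus₁ (hS : IsBilateralShift e ω S) :
    Tendsto (fun n : ℕ => (⨅ k : ℕ, beta ω (n + k) / beta ω k) ^ (1 / (n : ℝ))) atTop
      (𝓝 (rPlus₁ ω)) := by
  refine tendsto_nhds_limUnder ?_
  have h : ∀ n k : ℕ, beta ω (n + k) / beta ω k = ∏ i ∈ Finset.range n, ω ((k + i : ℕ) : ℤ) :=
    fun n k => by rw [add_comm, beta_add_div hS.pos]; simp
  simp only [h]
  exact exists_tendsto_iInf (w := fun n : ℕ => ω n) (fun n => hS.pos n)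
    (hS.bddAbove.mono (Set.range_comp_subset_range _ _))

theorem IsBilateralShift.tendsto_rMinus (hS : IsBilateralShift e ω S) :
    Tendsto (fun n : ℕ =>
      (⨆ k : ℕ, beta ω (-(k + 1)) / beta ω (-n - (k + 1))) ^ (1 / (n : ℝ))) atTop
      (𝓝 (rMinus ω)) := by
  refine tendsto_nhds_limUnder ?_
  simp only [beta_neg_div hS.pos]
  exact exists_tendsto_iSup (w := fun n : ℕ => ω (-(n : ℤ) - 2)) (fun n => hS.pos _)
    (hS.bddAbove.mono (Set.range_comp_subset_range _ _))

theorem IsBilateralShift.tendsto_rMinus₁ (hS : IsBilateralShift e ω S) :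
    Tendsto (fun n : ℕ =>
      (⨅ k : ℕ, beta ω (-(k + 1)) / beta ω (-n - (k + 1))) ^ (1 / (n : ℝ))) atTop
      (𝓝 (rMinus₁ ω)) := by
  refine tendsto_nhds_limUnder ?_
  simp only [beta_neg_div hS.pos]
  exact exists_tendsto_iInf (w := fun n : ℕ => ω (-(n : ℤ) - 2)) (fun n => hS.pos _)
    (hS.bddAbove.mono (Set.range_comp_subset_range _ _))

end

end

end WeightedShift

open Filter Topology

namespace WeightedShift

/-! ### Property (β): passage between local and global, and invariance under rotation. -/

section Bishop

variable {H : Type*} [NormedAddCommGroup H] [InnerProductSpace ℂ H]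

/-! Write q for `minModulus S` and r for `specRadius S`. The operator S - z is bounded below
whenever |z| differs from q and r. If |z| < q or |z| > r, then z is outside the spectrum. If q < |z|
< r, the equalities q = r^- and r_1^+ = r provide an n for which S^n contracts by less than |z|^n on
the negative indices and expands by more than |z|^n on the others. Since S^n only raises indices, it
is block triangular for this splitting, so S^n - z^n is bounded below
(`IsBilateralShift.isBoundedBelowAt_of_bounds`), and S - z is a right factor of it.

Lower bounds on arbitrarily small circles around each point give (β): by the maximum principle,
control of (T - w)F(w) on a circle controls F on the whole disc (`hasBishopAt_of_spheres`). Hence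
σ_β(S) lies on the two circles of radii q and r. As S is unitarily equivalent to cS for |c| = 1,
σ_β(S) is invariant under rotation, so each circle is contained in it or disjoint from it. If σ_β(S)
is empty, local solutions glue and (β) holds globally.

If S is not invertible, then q = 0 and the inner circle is a single point. For r > 0 it has a
punctured neighbourhood of points where S - z is bounded below, which suffices for (β) there; for r
= 0 the two circles coincide. -/

theorem mem_range_bishopMap {T : H →L[ℂ] H} {U : Set ℂ} {g : holo (H := H) U} :
    g ∈ Set.range (bishopMap T U) ↔
      ∃ F : ℂ → H, AnalyticOnNhd ℂ F U ∧ ∀ z : U, T (F z) - (z : ℂ) • F z = g.1 z := by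
  constructor
  · rintro ⟨f, rfl⟩
    obtain ⟨F, hF, hf⟩ := f.2
    exact ⟨F, hF, fun z => by simp [bishopMap, hf]⟩
  · rintro ⟨F, hF, h⟩
    refine ⟨⟨⟨fun z => F z, hF.continuousOn.domRestrict⟩, F, hF, fun _ => rfl⟩, ?_⟩
    ext z
    exact h z

theorem injective_bishopMap {T : H →L[ℂ] H} {U : Set ℂ} :
    Function.Injective (bishopMap T U) ↔
      ∀ F : ℂ → H, AnalyticOnNhd ℂ F U → (∀ z ∈ U, T (F z) - z • F z = 0) →
        ∀ z ∈ U, F z = 0 := by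
  rw [injective_iff_map_eq_zero]
  constructor
  · intro h F hF h0 z hz
    have := h ⟨⟨fun z => F z, hF.continuousOn.domRestrict⟩, F, hF, fun _ => rfl⟩
      (by ext z; exact h0 z z.2)
    exact congrArg (fun f : holo (H := H) U => f.1 ⟨z, hz⟩) this
  · intro h f hf
    obtain ⟨F, hF, hfF⟩ := f.2
    ext z
    rw [hfF]
    refine h F hF (fun w hw => ?_) z z.2
    have := congrArg (fun f : holo (H := H) U => f.1 ⟨w, hw⟩) hf
    simpa [bishopMap, hfF] using this

/-- The map `f ↦ A ∘ f ∘ φ` from `O(U, H)` to `O(V, H)`, for an analytic map `φ : V → U`. -/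
noncomputable def holoComp {U V : Set ℂ} (A : H →L[ℂ] H) (φ : ℂ → ℂ) (hφ : AnalyticOnNhd ℂ φ V)
    (hm : Set.MapsTo φ V U) (f : holo (H := H) U) : holo (H := H) V :=
  ⟨((⟨A, A.continuous⟩ : C(H, H)).comp f.1).comp
      ⟨hm.restrict, hφ.continuousOn.mapsToRestrict hm⟩, by
    obtain ⟨F, hF, hf⟩ := f.2
    refine ⟨fun z => A (F (φ z)), fun z hz => ?_, fun z => by simp [hf]⟩
    exact (A.analyticAt _).comp ((hF _ (hm hz)).comp (hφ z hz))⟩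

theorem holoComp_apply {U V : Set ℂ} (A : H →L[ℂ] H) (φ : ℂ → ℂ) (hφ : AnalyticOnNhd ℂ φ V)
    (hm : Set.MapsTo φ V U) (f : holo (H := H) U) (z : V) :
    (holoComp A φ hφ hm f).1 z = A (f.1 ⟨φ z, hm z.2⟩) := rfl

theorem continuous_holoComp {U V : Set ℂ} (A : H →L[ℂ] H) (φ : ℂ → ℂ)
    (hφ : AnalyticOnNhd ℂ φ V) (hm : Set.MapsTo φ V U) :
    Continuous (holoComp A φ hφ hm) := by
  refine Continuous.subtype_mk ?_ _
  exact (ContinuousMap.continuous_precomp _).comp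
    ((ContinuousMap.continuous_postcomp _).comp continuous_subtype_val)

/-- Restriction from U to V is continuous and intertwines T_U with T_V. -/
theorem holoComp_mem_closure {T : H →L[ℂ] H} {U V : Set ℂ} (hVU : V ⊆ U) {g : holo (H := H) U}
    (hg : g ∈ closure (Set.range (bishopMap T U))) :
    holoComp (.id ℂ H) id (fun _ _ => analyticAt_id) hVU g ∈
      closure (Set.range (bishopMap T V)) := by
  refine map_mem_closure (continuous_holoComp _ _ _ _) hg ?_
  rintro _ ⟨f, rfl⟩
  exact ⟨holoComp (.id ℂ H) id (fun _ _ => analyticAt_id) hVU f, rfl⟩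

/-- Local analytic solutions of `(T - z) F(z) = G(z)` glue together when they are unique. -/
theorem exists_solution_of_local {T : H →L[ℂ] H} {U : Set ℂ} {G : ℂ → H}
    (hinj : ∀ V : Set ℂ, IsOpen V → V ⊆ U → Function.Injective (bishopMap T V))
    (hloc : ∀ z ∈ U, ∃ V : Set ℂ, IsOpen V ∧ V ⊆ U ∧ z ∈ V ∧ ∃ F : ℂ → H,
      AnalyticOnNhd ℂ F V ∧ ∀ w ∈ V, T (F w) - w • F w = G w) :
    ∃ F : ℂ → H, AnalyticOnNhd ℂ F U ∧ ∀ w ∈ U, T (F w) - w • F w = G w := by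
  choose! V hVo hVU hzV F hF hFG using hloc
  -- Uniqueness on overlaps makes the diagonal choice w ↦ F w w agree near z with the single
  -- analytic function F z.
  have key : ∀ z ∈ U, ∀ w ∈ V z, F w w = F z w := by
    intro z hz w hw
    have hwU := hVU z hz hw
    have := injective_bishopMap.1
      (hinj (V z ∩ V w) ((hVo z hz).inter (hVo w hwU)) (Set.inter_subset_left.trans (hVU z hz)))
      (fun u => F w u - F z u)
      (fun u hu => (hF w hwU u hu.2).sub (hF z hz u hu.1))
      (fun u hu => by
        have h1 := hFG w hwU u hu.2
        have h2 := hFG z hz u hu.1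
        rw [map_sub, smul_sub, sub_sub_sub_comm, h1, h2, sub_self]) w ⟨hw, hzV w hwU⟩
    exact sub_eq_zero.1 this
  refine ⟨fun w => F w w, fun z hz => ?_, fun w hw => hFG w hw w (hzV w hw)⟩
  refine (hF z hz z (hzV z hz)).congr ?_
  filter_upwards [(hVo z hz).mem_nhds (hzV z hz)] with w hw using (key z hz w hw).symm

/-- Injectivity can be tested locally. A limit of elements of the range stays such a limit after
restriction to a small open set, so it is locally in the range, and the local solutions glue. -/
theorem bishop_of_forall_hasBishopAt {T : H →L[ℂ] H} {U : Set ℂ} (hU : IsOpen U)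
    (h : ∀ z ∈ U, HasBishopAt T z) :
    Function.Injective (bishopMap T U) ∧ IsClosed (Set.range (bishopMap T U)) := by
  have hinj : ∀ V : Set ℂ, IsOpen V → V ⊆ U → Function.Injective (bishopMap T V) := by
    intro V hV hVU
    refine injective_bishopMap.2 fun F hF h0 z hz => ?_
    obtain ⟨N, hN, hzN, hβ⟩ := h z (hVU hz)
    exact injective_bishopMap.1 (hβ (V ∩ N) (hV.inter hN) Set.inter_subset_right).1 F
      (hF.mono Set.inter_subset_left) (fun w hw => h0 w hw.1) z ⟨hz, hzN⟩
  refine ⟨hinj U hU subset_rfl, isClosed_of_closure_subset fun g hg => ?_⟩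
  obtain ⟨G, hG, hgG⟩ := g.2
  obtain ⟨F, hF, hFG⟩ := exists_solution_of_local (G := G) hinj fun z hz => by
    obtain ⟨N, hN, hzN, hβ⟩ := h z hz
    have hcl := (hβ (U ∩ N) (hU.inter hN) Set.inter_subset_right).2
    have := hcl.closure_subset (holoComp_mem_closure (Set.inter_subset_left (t := N)) hg)
    obtain ⟨F, hF, hFg⟩ := mem_range_bishopMap.1 this
    exact ⟨U ∩ N, hU.inter hN, Set.inter_subset_left, ⟨hz, hzN⟩, F, hF, fun w hw =>
      (hFg ⟨w, hw⟩).trans (hgG _)⟩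
  exact mem_range_bishopMap.2 ⟨F, hF, fun z => (hFG z z.2).trans (hgG z).symm⟩

theorem hasBishop_of_sigmaBeta_eq_empty {T : H →L[ℂ] H} (h : sigmaBeta T = ∅) : HasBishop T :=
  fun _ hU => bishop_of_forall_hasBishopAt hU fun z _ => by
    by_contra hz
    exact (h ▸ (show z ∈ sigmaBeta T from hz) : z ∈ (∅ : Set ℂ))

theorem HasBishopAt.rotate {T : H →L[ℂ] H} {c z₀ : ℂ} (hc : c ≠ 0) (A : H ≃ₗᵢ[ℂ] H)
    (hA : ∀ x, A (T x) = c • T (A x)) (h : HasBishopAt T (c * z₀)) : HasBishopAt T z₀ := by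
  obtain ⟨V, hV, hzV, hβ⟩ := h
  refine ⟨(fun z => c * z) ⁻¹' V, hV.preimage (by fun_prop), hzV, fun U hU hUV => ?_⟩
  -- For c ≠ 0 this is the dilate cU.
  let U' : Set ℂ := (fun z => c⁻¹ * z) ⁻¹' U
  have hU'V : U' ⊆ V := fun z hz => by simpa [hc] using hUV hz
  have hm : Set.MapsTo (fun z => c⁻¹ * z) U' U := fun z hz => hz
  have hm' : Set.MapsTo (fun z => c * z) U U' := fun z hz => by simpa [U', hc] using hz
  have ha : ∀ (d : ℂ) (W : Set ℂ), AnalyticOnNhd ℂ (fun z => d * z) W := fun d W z _ => by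
    fun_prop
  have hA' : ∀ x, T (A x) = c⁻¹ • A (T x) := fun x => by rw [hA, inv_smul_smul₀ hc]
  have hB : ∀ x, T (A.symm x) = c • A.symm (T x) := fun x => by
    apply A.injective
    simp [hA]
  have hpush : ∀ F : ℂ → H, AnalyticOnNhd ℂ F U →
      AnalyticOnNhd ℂ (fun z => A.symm (F (c⁻¹ * z))) U' := fun F hF z hz =>
    ((A.symm : H →L[ℂ] H).analyticAt _).comp ((hF _ (hm hz)).comp (ha _ _ z hz))
  have hpull : ∀ F : ℂ → H, AnalyticOnNhd ℂ F U' →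
      AnalyticOnNhd ℂ (fun z => A (F (c * z))) U := fun F hF z hz =>
    ((A : H →L[ℂ] H).analyticAt _).comp ((hF _ (hm' hz)).comp (ha _ _ z hz))
  obtain ⟨h1, h2⟩ := hβ U' (hU.preimage (by fun_prop)) hU'V
  constructor
  · refine injective_bishopMap.2 fun F hF h0 z hz => ?_
    have := injective_bishopMap.1 h1 _ (hpush F hF) (fun w hw => ?_) (c * z) (hm' hz)
    · simpa [hc] using this
    · have h3 := h0 _ (hm hw)
      rw [sub_eq_zero] at h3
      simp [hB, h3, smul_smul, hc]
  -- The identity (T - w)A⁻¹F(w/c) = cA⁻¹(T - w/c)F(w/c) shows that the range over U is the preimage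
  -- of the closed range over cU under g ↦ cA⁻¹g(·/c); this explains the scalar c.
  · convert h2.preimage
      (continuous_holoComp (c • (A.symm : H →L[ℂ] H)) (fun z => c⁻¹ * z) (ha _ _) hm) using 1
    ext g
    rw [Set.mem_preimage, mem_range_bishopMap, mem_range_bishopMap]
    constructor
    · rintro ⟨F, hF, hFg⟩
      refine ⟨_, hpush F hF, fun z => ?_⟩
      rw [holoComp_apply, ← hFg]
      simp [hB, smul_sub, smul_smul, hc]
    · rintro ⟨F, hF, hFg⟩
      refine ⟨_, hpull F hF, fun z => ?_⟩
      have h3 := congrArg (fun x => c⁻¹ • A x) (hFg ⟨c * z, hm' z.2⟩)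
      simp only [holoComp_apply] at h3
      simpa [hA', smul_sub, smul_smul, hc] using h3

end Bishop

/-! ### Property (β) from lower bounds on small circles. -/

section Criterion

variable {H : Type*} [NormedAddCommGroup H] [InnerProductSpace ℂ H]

theorem norm_le_of_sphere_bound {F : ℂ → H} {z : ℂ} {ε C : ℝ} (hε : 0 < ε)
    (hF : AnalyticOnNhd ℂ F (Metric.closedBall z ε)) (h : ∀ w ∈ Metric.sphere z ε, ‖F w‖ ≤ C)
    {w : ℂ} (hw : w ∈ Metric.closedBall z ε) : ‖F w‖ ≤ C := by
  refine Complex.norm_le_of_forall_mem_frontier_norm_le (U := Metric.ball z ε)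
    Metric.isBounded_ball ?_ ?_ (by rwa [closure_ball z hε.ne'])
  · refine DifferentiableOn.diffContOnCl ?_
    rw [closure_ball z hε.ne']
    exact hF.differentiableOn
  · rwa [frontier_ball z hε.ne']

/-- The maximum principle for `T - w` bounded below on a circle. -/
theorem norm_le_of_bounded_below_on_sphere {T : H →L[ℂ] H} {F : ℂ → H} {z : ℂ} {ε c δ : ℝ}
    (hε : 0 < ε) (hc : 0 < c)
    (hT : ∀ w ∈ Metric.sphere z ε, ∀ x, c * ‖x‖ ≤ ‖T x - w • x‖)
    (hF : AnalyticOnNhd ℂ F (Metric.closedBall z ε))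
    (h : ∀ w ∈ Metric.sphere z ε, ‖T (F w) - w • F w‖ ≤ δ)
    {w : ℂ} (hw : w ∈ Metric.closedBall z ε) : ‖F w‖ ≤ δ / c :=
  norm_le_of_sphere_bound hε hF (fun u hu => by
    rw [le_div_iff₀' hc]
    exact (hT u hu _).trans (h u hu)) hw

/-- `T - z` is bounded below. -/
def IsBoundedBelowAt (T : H →L[ℂ] H) (z : ℂ) : Prop :=
  ∃ c, 0 < c ∧ ∀ x, c * ‖x‖ ≤ ‖T x - z • x‖

theorem IsBoundedBelowAt.exists_nhds {T : H →L[ℂ] H} {z : ℂ} (h : IsBoundedBelowAt T z) :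
    ∃ η, 0 < η ∧ ∃ c, 0 < c ∧ ∀ w ∈ Metric.ball z η, ∀ x, c * ‖x‖ ≤ ‖T x - w • x‖ := by
  obtain ⟨c, hc, hT⟩ := h
  refine ⟨c / 2, by positivity, c / 2, by positivity, fun w hw x => ?_⟩
  have h1 : ‖(w - z) • x‖ ≤ c / 2 * ‖x‖ := by
    rw [norm_smul, ← dist_eq_norm]
    exact mul_le_mul_of_nonneg_right (Metric.mem_ball.1 hw).le (norm_nonneg _)
  have h2 : T x - z • x = (T x - w • x) + (w - z) • x := by rw [sub_smul]; abel
  have h3 := (hT x).trans ((congrArg norm h2).le.trans (norm_add_le _ _))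
  linarith

/-- A lower bound at a point persists nearby with half the constant; finitely many such
neighbourhoods cover K. -/
theorem exists_bounded_below_of_isCompact {T : H →L[ℂ] H} {K : Set ℂ} (hK : IsCompact K)
    (h : ∀ z ∈ K, IsBoundedBelowAt T z) :
    ∃ c, 0 < c ∧ ∀ w ∈ K, ∀ x, c * ‖x‖ ≤ ‖T x - w • x‖ := by
  refine hK.induction_on (p := fun K => ∃ c, 0 < c ∧ ∀ w ∈ K, ∀ x, c * ‖x‖ ≤ ‖T x - w • x‖)
    ⟨1, one_pos, by simp⟩ ?_ ?_ ?_
  · rintro s t hst ⟨c, hc, hT⟩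
    exact ⟨c, hc, fun w hw => hT w (hst hw)⟩
  · rintro s t ⟨c, hc, hs⟩ ⟨d, hd, ht⟩
    refine ⟨min c d, lt_min hc hd, ?_⟩
    rintro w (hw | hw) x
    · exact (mul_le_mul_of_nonneg_right (min_le_left _ _) (norm_nonneg _)).trans (hs w hw x)
    · exact (mul_le_mul_of_nonneg_right (min_le_right _ _) (norm_nonneg _)).trans (ht w hw x)
  · intro z hz
    obtain ⟨η, hη, hc⟩ := (h z hz).exists_nhds
    exact ⟨Metric.ball z η, mem_nhdsWithin_of_mem_nhds (Metric.ball_mem_nhds z hη), hc⟩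

variable [CompleteSpace H]

/-- If (T - w)F_n(w) converges to G uniformly on the closed disc, the lower bound on the circle and
the maximum principle make F_n uniformly Cauchy on that disc. The limit is analytic inside and
solves the equation. -/
theorem exists_solution_on_ball {T : H →L[ℂ] H} {U : Set ℂ} {z : ℂ} {ε c : ℝ}
    (hε : 0 < ε) (hU : Metric.closedBall z ε ⊆ U) (hc : 0 < c)
    (hT : ∀ w ∈ Metric.sphere z ε, ∀ x, c * ‖x‖ ≤ ‖T x - w • x‖)
    {g : holo (H := H) U} (hg : g ∈ closure (Set.range (bishopMap T U))) {G : ℂ → H}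
    (hG : ∀ z : U, g.1 z = G z) :
    ∃ F : ℂ → H, AnalyticOnNhd ℂ F (Metric.ball z ε) ∧
      ∀ w ∈ Metric.ball z ε, T (F w) - w • F w = G w := by
  have hK : IsCompact ((↑) ⁻¹' Metric.closedBall z ε : Set U) := by
    rw [Topology.IsInducing.subtypeVal.isCompact_iff, Subtype.image_preimage_coe,
      Set.inter_eq_right.2 hU]
    exact isCompact_closedBall z ε
  have happ : ∀ n : ℕ, ∃ F : ℂ → H, AnalyticOnNhd ℂ F U ∧
      ∀ w ∈ Metric.closedBall z ε, ‖T (F w) - w • F w - G w‖ < 1 / ((n : ℝ) + 1) := by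
    intro n
    have hunif := ContinuousMap.tendsto_iff_forall_isCompact_tendstoUniformlyOn.1
      (tendsto_id (x := 𝓝 g.1)) _ hK
    have hev := (continuous_subtype_val.tendsto g).eventually
      (Metric.tendstoUniformlyOn_iff.1 hunif (1 / ((n : ℝ) + 1)) (by positivity))
    obtain ⟨f, hf, hfr⟩ := mem_closure_iff_nhds.1 hg _ hev
    obtain ⟨F, hF, hFf⟩ := mem_range_bishopMap.1 hfr
    refine ⟨F, hF, fun w hw => ?_⟩
    have := hf ⟨w, hU hw⟩ hw
    rw [dist_comm, dist_eq_norm, id, ← hFf, hG] at this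
    exact this
  choose F hF hFG using happ
  have hFan : ∀ n, AnalyticOnNhd ℂ (F n) (Metric.closedBall z ε) := fun n => (hF n).mono hU
  have hdiff : ∀ N m n : ℕ, N ≤ m → N ≤ n → ∀ w ∈ Metric.closedBall z ε,
      ‖F m w - F n w‖ ≤ (2 * (1 / ((N : ℝ) + 1))) / c := by
    intro N m n hm hn w hw
    refine norm_le_of_bounded_below_on_sphere (F := fun w => F m w - F n w) hε hc hT
      ((hFan m).sub (hFan n)) (fun u hu => ?_) hw
    have hu' := Metric.sphere_subset_closedBall hu
    have h1 := (hFG m u hu').le.trans (Nat.one_div_le_one_div hm)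
    have h2 := (hFG n u hu').le.trans (Nat.one_div_le_one_div hn)
    calc ‖T (F m u - F n u) - u • (F m u - F n u)‖
        = ‖(T (F m u) - u • F m u - G u) - (T (F n u) - u • F n u - G u)‖ := by
          rw [map_sub, smul_sub]; congr 1; abel
      _ ≤ _ := (norm_sub_le _ _).trans (by linarith)
  have hlim0 : Tendsto (fun N : ℕ => (2 * (1 / ((N : ℝ) + 1))) / c) atTop (𝓝 0) := by
    simpa using (tendsto_one_div_add_atTop_nhds_zero_nat.const_mul (2 : ℝ)).div_const c
  have hcau : UniformCauchySeqOn F atTop (Metric.closedBall z ε) := by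
    refine Metric.uniformCauchySeqOn_iff.2 fun η hη => ?_
    obtain ⟨N, hN⟩ := (hlim0.eventually (gt_mem_nhds hη)).exists
    exact ⟨N, fun m hm n hn w hw => (dist_eq_norm (F m w) (F n w)).trans_lt
      ((hdiff N m n hm hn w hw).trans_lt hN)⟩
  have hpt : ∀ w ∈ Metric.closedBall z ε, ∃ l, Tendsto (fun n => F n w) atTop (𝓝 l) :=
    fun w hw => cauchySeq_tendsto_of_complete (hcau.cauchySeq hw)
  choose! L hL using hpt
  have hLU := hcau.tendstoUniformlyOn_of_tendsto hL
  refine ⟨L, ?_, fun w hw => ?_⟩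
  · refine DifferentiableOn.analyticOnNhd ?_ Metric.isOpen_ball
    exact (hLU.mono Metric.ball_subset_closedBall).tendstoLocallyUniformlyOn.differentiableOn
      (Eventually.of_forall fun n =>
        ((hFan n).mono Metric.ball_subset_closedBall).differentiableOn) Metric.isOpen_ball
  · have hw' := Metric.ball_subset_closedBall hw
    have h1 : Tendsto (fun n => T (F n w) - w • F n w - G w) atTop
        (𝓝 (T (L w) - w • L w - G w)) :=
      (((T.continuous.tendsto _).comp (hL w hw')).sub ((hL w hw').const_smul w)).sub_const _
    have h2 : Tendsto (fun n => T (F n w) - w • F n w - G w) atTop (𝓝 0) :=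
      squeeze_zero_norm (fun n => (hFG n w hw').le) tendsto_one_div_add_atTop_nhds_zero_nat
    exact sub_eq_zero.1 (tendsto_nhds_unique h1 h2)

/-- If `T - w` is uniformly bounded below on arbitrarily small circles around every point of the
open set `V`, then `T` has property (β) at every point of `V`. -/
theorem hasBishopAt_of_spheres {T : H →L[ℂ] H} {V : Set ℂ} (hV : IsOpen V)
    (h : ∀ z ∈ V, ∀ δ > 0, ∃ ε, 0 < ε ∧ ε < δ ∧ ∃ c, 0 < c ∧
      ∀ w ∈ Metric.sphere z ε, ∀ x, c * ‖x‖ ≤ ‖T x - w • x‖) {z₀ : ℂ} (hz₀ : z₀ ∈ V) :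
    HasBishopAt T z₀ := by
  refine ⟨V, hV, hz₀, fun U hU hUV => ?_⟩
  have hball : ∀ W : Set ℂ, IsOpen W → W ⊆ U → ∀ z ∈ W, ∃ ε, 0 < ε ∧
      Metric.closedBall z ε ⊆ W ∧ ∃ c, 0 < c ∧
      ∀ w ∈ Metric.sphere z ε, ∀ x, c * ‖x‖ ≤ ‖T x - w • x‖ := by
    intro W hW hWU z hz
    obtain ⟨δ, hδ, hδW⟩ := Metric.isOpen_iff.1 hW z hz
    obtain ⟨ε, hε, hεδ, hc⟩ := h z (hUV (hWU hz)) δ hδ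
    exact ⟨ε, hε, (Metric.closedBall_subset_ball hεδ).trans hδW, hc⟩
  have hinj : ∀ W : Set ℂ, IsOpen W → W ⊆ U → Function.Injective (bishopMap T W) := by
    intro W hW hWU
    refine injective_bishopMap.2 fun F hF h0 z hz => ?_
    obtain ⟨ε, hε, hεW, c, hc, hT⟩ := hball W hW hWU z hz
    have := norm_le_of_bounded_below_on_sphere (δ := 0) hε hc hT (hF.mono hεW)
      (fun w hw => by rw [h0 w (hεW (Metric.sphere_subset_closedBall hw)), norm_zero])
      (Metric.mem_closedBall_self hε.le)
    simpa using this
  refine ⟨hinj U hU subset_rfl, isClosed_of_closure_subset fun g hg => ?_⟩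
  obtain ⟨G, hG, hgG⟩ := g.2
  obtain ⟨F, hF, hFG⟩ := exists_solution_of_local (G := G) hinj fun z hz => by
    obtain ⟨ε, hε, hεU, c, hc, hT⟩ := hball U hU subset_rfl z hz
    exact ⟨Metric.ball z ε, Metric.isOpen_ball, Metric.ball_subset_closedBall.trans hεU,
      Metric.mem_ball_self hε, exists_solution_on_ball hε hεU hc hT hg hgG⟩
  exact mem_range_bishopMap.2 ⟨F, hF, fun z => (hFG z z.2).trans (hgG z).symm⟩

/-- If `T - w` is bounded below for all `w ≠ z₀` close to `z₀`, then `T` has property (β)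
at `z₀`. -/
theorem hasBishopAt_of_punctured {T : H →L[ℂ] H} {z₀ : ℂ} {ρ : ℝ} (hρ : 0 < ρ)
    (h : ∀ w ∈ Metric.ball z₀ ρ, w ≠ z₀ → IsBoundedBelowAt T w) : HasBishopAt T z₀ := by
  refine hasBishopAt_of_spheres Metric.isOpen_ball (fun z hz δ hδ => ?_)
    (Metric.mem_ball_self hρ)
  -- Every point z of the ball, and not only z₀, needs small circles that miss z₀. Around z₀ any
  -- positive radius does this; around another z the whole disc can be kept away from z₀.
  obtain ⟨τ, hτ, hsub⟩ : ∃ τ, 0 < τ ∧ ∀ w ∈ Metric.ball z τ, w ≠ z →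
      w ∈ Metric.ball z₀ ρ ∧ w ≠ z₀ := by
    rcases eq_or_ne z z₀ with rfl | hne
    · exact ⟨ρ, hρ, fun w hw hne => ⟨hw, hne⟩⟩
    · obtain ⟨τ, hτ, hs⟩ := Metric.isOpen_iff.1
        (Metric.isOpen_ball.inter (isOpen_ne (x := z₀))) z ⟨hz, hne⟩
      exact ⟨τ, hτ, fun w hw _ => hs hw⟩
  have hm : 0 < min τ δ := lt_min hτ hδ
  refine ⟨min τ δ / 2, by positivity, (half_lt_self hm).trans_le (min_le_right _ _),
    exists_bounded_below_of_isCompact (isCompact_sphere _ _) fun w hw => ?_⟩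
  have hw' : dist w z = min τ δ / 2 := hw
  obtain ⟨h1, h2⟩ := hsub w
    (Metric.mem_ball.2 (hw'.trans_lt ((half_lt_self hm).trans_le (min_le_left _ _))))
    (dist_pos.1 (by rw [hw']; positivity))
  exact h w h1 h2

end Criterion

/-! ### Powers of the shift as weighted translations of the basis. -/

section Shift

variable {H : Type*} [NormedAddCommGroup H] [InnerProductSpace ℂ H]
  {e : HilbertBasis ℤ ℂ H} {ω : ℤ → ℝ} {S : H →L[ℂ] H}

/-- The geometric sum p gives S^n - z^n = p(S - z), so a lower bound for the left side passes to S -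
z at the cost of ‖p‖. -/
theorem isBoundedBelowAt_of_pow {n : ℕ} {z : ℂ} (h : IsBoundedBelowAt (S ^ n) (z ^ n)) :
    IsBoundedBelowAt S z := by
  obtain ⟨c, hc, hT⟩ := h
  have hcomm : Commute S (algebraMap ℂ (H →L[ℂ] H) z) := (Algebra.commutes z S).symm
  have hfac := hcomm.geom_sum₂_mul n
  set p := ∑ i ∈ Finset.range n, S ^ i * (algebraMap ℂ (H →L[ℂ] H) z) ^ (n - 1 - i)
  have hle : ∀ x, c * ‖x‖ ≤ (‖p‖ + 1) * ‖S x - z • x‖ := by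
    intro x
    have h1 : p (S x - z • x) = (S ^ n) x - z ^ n • x := by
      have := congrArg (fun A : H →L[ℂ] H => A x) hfac
      rw [← map_pow] at this
      simpa only [Algebra.algebraMap_eq_smul_one, mul_apply_eq_comp, sub_apply, smul_apply,
        one_apply_eq_self] using this
    have h2 := hT x
    rw [← h1] at h2
    exact (h2.trans (p.le_opNorm _)).trans
      (mul_le_mul_of_nonneg_right (by linarith) (norm_nonneg _))
  have hp : 0 < ‖p‖ + 1 := by positivity
  refine ⟨c / (‖p‖ + 1), by positivity, fun x => ?_⟩
  rw [div_mul_eq_mul_div, div_le_iff₀' hp]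
  exact hle x

theorem hasSum_norm_inner_sq (e : HilbertBasis ℤ ℂ H) (x : H) :
    HasSum (fun i => ‖inner ℂ (e i) x‖ ^ 2) (‖x‖ ^ 2) := by
  have h := (e.hasSum_inner_mul_inner x x).mapL Complex.reCLM
  convert h using 1
  · ext i
    rw [← inner_conj_symm x (e i), Complex.reCLM_apply, ← Complex.normSq_eq_conj_mul_self,
      Complex.ofReal_re, Complex.normSq_eq_norm_sq]
  · rw [Complex.reCLM_apply, inner_self_eq_norm_sq_to_K]
    norm_cast

theorem clm_ext_basis {F : Type*} [NormedAddCommGroup F] [NormedSpace ℂ F] {A B : H →L[ℂ] F}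
    (h : ∀ n, A (e n) = B (e n)) : A = B := by
  refine ContinuousLinearMap.ext_on (s := Set.range e) ?_ ?_
  · exact Submodule.dense_iff_topologicalClosure_eq_top.2 e.dense_span
  · rintro _ ⟨n, rfl⟩
    exact h n

theorem inner_basis (e : HilbertBasis ℤ ℂ H) (i j : ℤ) :
    inner ℂ (e i) (e j) = if i = j then (1 : ℂ) else 0 :=
  orthonormal_iff_ite.1 e.orthonormal i j

theorem inner_weighted_translation {T : H →L[ℂ] H} {w : ℤ → ℂ} {n : ℤ}
    (hT : ∀ m, T (e m) = w m • e (m + n)) (m : ℤ) (x : H) :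
    inner ℂ (e (m + n)) (T x) = w m * inner ℂ (e m) x := by
  have : (innerSL ℂ (e (m + n))).comp T = w m • innerSL ℂ (e m) := by
    refine clm_ext_basis (e := e) fun k => ?_
    simp only [ContinuousLinearMap.comp_apply, hT, innerSL_apply_apply, inner_smul_right,
      inner_basis, smul_apply, smul_eq_mul, add_left_inj]
    split_ifs with hk
    · rw [hk]
    · simp
  exact congrArg (fun A : H →L[ℂ] ℂ => A x) this

/-- Parseval's identity for T x, reindexed by the translation. The upper and lower norm estimates
below then involve only the weights on the support of x. -/
theorem hasSum_weighted_translation {T : H →L[ℂ] H} {w : ℤ → ℂ} {n : ℤ}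
    (hT : ∀ m, T (e m) = w m • e (m + n)) (x : H) :
    HasSum (fun m => ‖w m‖ ^ 2 * ‖inner ℂ (e m) x‖ ^ 2) (‖T x‖ ^ 2) := by
  have h := (Equiv.hasSum_iff (Equiv.addRight n)).2 (hasSum_norm_inner_sq e (T x))
  refine h.congr_fun fun m => ?_
  simp only [Function.comp_apply, Equiv.coe_addRight]
  rw [inner_weighted_translation hT, norm_mul, mul_pow]

theorem norm_weighted_translation_le {T : H →L[ℂ] H} {w : ℤ → ℂ} {n : ℤ}
    (hT : ∀ m, T (e m) = w m • e (m + n)) {M : ℝ} (hM : 0 ≤ M) {x : H}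
    (h : ∀ m, inner ℂ (e m) x ≠ 0 → ‖w m‖ ≤ M) : ‖T x‖ ≤ M * ‖x‖ := by
  refine le_of_sq_le_sq ?_ (by positivity)
  rw [mul_pow]
  refine hasSum_le (fun m => ?_) (hasSum_weighted_translation hT x)
    ((hasSum_norm_inner_sq e x).mul_left (M ^ 2))
  by_cases h0 : inner ℂ (e m) x = 0
  · simp [h0]
  · have := h m h0
    gcongr

theorem le_norm_weighted_translation {T : H →L[ℂ] H} {w : ℤ → ℂ} {n : ℤ}
    (hT : ∀ m, T (e m) = w m • e (m + n)) {M : ℝ} (hM : 0 ≤ M) {x : H}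
    (h : ∀ m, inner ℂ (e m) x ≠ 0 → M ≤ ‖w m‖) : M * ‖x‖ ≤ ‖T x‖ := by
  refine le_of_sq_le_sq ?_ (norm_nonneg _)
  rw [mul_pow]
  refine hasSum_le (fun m => ?_) ((hasSum_norm_inner_sq e x).mul_left (M ^ 2))
    (hasSum_weighted_translation hT x)
  by_cases h0 : inner ℂ (e m) x = 0
  · simp [h0]
  · have := h m h0
    gcongr

theorem IsBilateralShift.pow_apply_basis (hS : IsBilateralShift e ω S) (n : ℕ) (m : ℤ) :
    (S ^ n) (e m) = ((beta ω (m + n) / beta ω m : ℝ) : ℂ) • e (m + n) := by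
  induction n with
  | zero => simp [(beta_pos hS.pos m).ne']
  | succ n ih =>
    rw [pow_succ', mul_apply_eq_comp, ih, map_smul, hS.apply_basis, smul_smul,
      Nat.cast_succ, ← add_assoc, beta_succ hS.pos]
    congr 1
    push_cast
    ring

theorem isBoundedBelowAt_of_notMem_spectrum {z : ℂ} (h : z ∉ spectrum ℂ S) :
    IsBoundedBelowAt S z := by
  obtain ⟨u, hu⟩ := spectrum.notMem_iff.1 h
  set B : H →L[ℂ] H := ↑u⁻¹
  have hB : ∀ x, B (z • x - S x) = x := fun x => by
    have h1 : B * (algebraMap ℂ (H →L[ℂ] H) z - S) = 1 := by rw [← hu]; exact u.inv_mul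
    have := congrArg (fun A : H →L[ℂ] H => A x) h1
    simpa [Algebra.algebraMap_eq_smul_one] using this
  have hp : 0 < ‖B‖ + 1 := by positivity
  refine ⟨(‖B‖ + 1)⁻¹, by positivity, fun x => ?_⟩
  rw [inv_mul_le_iff₀ hp, norm_sub_rev]
  calc ‖x‖ = ‖B (z • x - S x)‖ := by rw [hB]
    _ ≤ ‖B‖ * ‖z • x - S x‖ := B.le_opNorm _
    _ ≤ _ := by gcongr; linarith

theorem nontrivial_of_hilbertBasis (e : HilbertBasis ℤ ℂ H) : Nontrivial H :=
  ⟨e 0, 0, e.orthonormal.ne_zero 0⟩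

theorem minModulus_le_norm {z : ℂ} (h : z ∈ spectrum ℂ S) : minModulus S ≤ ‖z‖ :=
  csInf_le ⟨0, by rintro _ ⟨w, -, rfl⟩; exact norm_nonneg w⟩ ⟨z, h, rfl⟩

theorem minModulus_eq_zero (h : ¬ IsUnit S) : minModulus S = 0 := by
  refine le_antisymm ?_ (Real.sInf_nonneg ?_)
  · simpa using minModulus_le_norm ((spectrum.zero_mem_iff ℂ).2 h)
  · rintro _ ⟨w, -, rfl⟩
    exact norm_nonneg w

/-! ### Lower bounds in the annulus between the two circles. -/

variable [CompleteSpace H]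

/-- The orthogonal projection that keeps the basis vectors with negative index. -/
theorem exists_projection_neg (e : HilbertBasis ℤ ℂ H) : ∃ P : H →L[ℂ] H, ‖P‖ ≤ 1 ∧
    ∀ n, P (e n) = (if n < 0 then (1 : ℂ) else 0) • e (n + 0) := by
  let K : Submodule ℂ H := (Submodule.span ℂ (e '' Set.Iio 0)).topologicalClosure
  have : CompleteSpace K :=
    (Submodule.isClosed_topologicalClosure _).completeSpace_coe
  refine ⟨K.starProjection, K.starProjection_norm_le, fun n => ?_⟩
  rw [add_zero]
  split_ifs with hn
  · rw [one_smul]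
    exact Submodule.starProjection_eq_self_iff.2
      (Submodule.le_topologicalClosure _ (Submodule.subset_span ⟨n, hn, rfl⟩))
  · rw [zero_smul, Submodule.starProjection_apply_eq_zero_iff, Submodule.orthogonal_closure,
      Submodule.mem_orthogonal]
    intro u hu
    induction hu using Submodule.span_induction with
    | mem x hx =>
      obtain ⟨k, hk, rfl⟩ := hx
      rw [inner_basis, if_neg]
      rintro rfl
      exact hn hk
    | zero => simp
    | add x y _ _ hx hy => rw [inner_add_left, hx, hy, add_zero]
    | smul a x _ hx => rw [inner_smul_left, hx, mul_zero]

/-- With y = ‖(S^n - z^n)x‖, the component P x is bounded by y because the negative block of S^n has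
norm at most a < |z|^n. The component x - P x is then bounded by y and ‖P x‖, because S^n expands it
by at least b > |z|^n. -/
theorem IsBilateralShift.isBoundedBelowAt_of_bounds (hS : IsBilateralShift e ω S) {n : ℕ}
    {z : ℂ} {a b : ℝ} (ha : a < ‖z‖ ^ n) (hb : ‖z‖ ^ n < b)
    (hma : ∀ k : ℕ, beta ω (-(k + 1)) / beta ω (-n - (k + 1)) ≤ a)
    (hpb : ∀ k : ℕ, b ≤ beta ω (n + k) / beta ω k) : IsBoundedBelowAt S z := by
  refine isBoundedBelowAt_of_pow (n := n) ?_
  have ha0 : 0 ≤ a := (div_nonneg (beta_pos hS.pos _).le (beta_pos hS.pos _).le).trans (hma 0)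
  obtain ⟨P, hP1, hP⟩ := exists_projection_neg e
  have hPle : ∀ x, ‖P x‖ ≤ ‖x‖ := fun x => by
    simpa using P.le_of_opNorm_le hP1 x
  have hPP : P.comp P = P := clm_ext_basis (e := e) fun m => by
    simp only [ContinuousLinearMap.comp_apply, hP, add_zero, map_smul]
    split_ifs <;> simp
  -- Triangularity: raising a nonnegative index by n never produces a negative one.
  have hPS : P.comp ((S ^ n).comp P) = P.comp (S ^ n) := clm_ext_basis (e := e) fun m => by
    simp only [ContinuousLinearMap.comp_apply, hP, hS.pow_apply_basis, add_zero, map_smul]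
    by_cases hm : m < 0
    · simp [hm]
    · rw [if_neg hm, if_neg (by lia)]
      simp
  have hT : ∀ m, (P.comp (S ^ n)) (e m) = ((if m + n < 0 then
      ((beta ω (m + n) / beta ω m : ℝ) : ℂ) else 0) : ℂ) • e (m + n) := fun m => by
    simp only [ContinuousLinearMap.comp_apply, hP, hS.pow_apply_basis, add_zero, map_smul]
    split_ifs <;> simp
  have hquot : ∀ m : ℤ, ‖((beta ω (m + n) / beta ω m : ℝ) : ℂ)‖ = beta ω (m + n) / beta ω m :=
    fun m => by
      rw [Complex.norm_real, Real.norm_of_nonneg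
        (div_nonneg (beta_pos hS.pos _).le (beta_pos hS.pos _).le)]
  have hneg : ∀ x, ‖P ((S ^ n) x)‖ ≤ a * ‖P x‖ := by
    intro x
    have h1 : P ((S ^ n) x) = (P.comp (S ^ n)) (P x) :=
      (congrArg (fun A : H →L[ℂ] H => A x) hPS).symm
    rw [h1]
    refine norm_weighted_translation_le hT ha0 fun m _ => ?_
    split_ifs with hm
    · rw [hquot]
      -- The index k is read off the target m + n < 0, so that the weight becomes the quotient
      -- bounded by `hma`.
      obtain ⟨k, hk⟩ : ∃ k : ℕ, m + n = -((k : ℤ) + 1) := ⟨(-(m + n) - 1).toNat, by lia⟩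
      have := hma k
      rwa [← hk, show (-n - (k + 1) : ℤ) = m by lia] at this
    · simpa using ha0
  have hpos : ∀ x, b * ‖x - P x‖ ≤ ‖(S ^ n) (x - P x)‖ := by
    intro x
    refine le_norm_weighted_translation (hS.pow_apply_basis n)
      ((pow_nonneg (norm_nonneg z) n).trans hb.le) fun m hm => ?_
    rw [hquot]
    have hm0 : 0 ≤ m := by
      by_contra hlt
      refine hm ?_
      have := inner_weighted_translation hP m x
      rw [if_pos (by lia), add_zero, one_mul] at this
      rw [inner_sub_right, this, sub_self]
    lift m to ℕ using hm0
    rw [add_comm]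
    exact hpb m
  have hA : ∀ x, (‖z‖ ^ n - a) * ‖P x‖ ≤ ‖(S ^ n) x - z ^ n • x‖ := by
    intro x
    have h1 : ‖z ^ n • P x‖ = ‖z‖ ^ n * ‖P x‖ := by rw [norm_smul, norm_pow]
    have h2 : z ^ n • P x = P ((S ^ n) x) - P ((S ^ n) x - z ^ n • x) := by
      rw [map_sub, map_smul]; abel
    have h3 := norm_sub_le (P ((S ^ n) x)) (P ((S ^ n) x - z ^ n • x))
    rw [← h2, h1] at h3
    have h4 := hPle ((S ^ n) x - z ^ n • x)
    have h5 := hneg x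
    rw [sub_mul]
    linarith
  have hB : ∀ x, (b - ‖z‖ ^ n) * ‖x - P x‖ ≤
      ‖(S ^ n) x - z ^ n • x‖ + (‖S ^ n‖ + ‖z‖ ^ n) * ‖P x‖ := by
    intro x
    have h1 : (S ^ n) (x - P x) = z ^ n • (x - P x) + ((S ^ n) x - z ^ n • x) -
        ((S ^ n) (P x) - z ^ n • P x) := by
      rw [map_sub, smul_sub]; abel
    have h2 := hpos x
    rw [h1] at h2
    have h3 := norm_sub_le (z ^ n • (x - P x) + ((S ^ n) x - z ^ n • x))
      ((S ^ n) (P x) - z ^ n • P x)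
    have h4 := norm_add_le (z ^ n • (x - P x)) ((S ^ n) x - z ^ n • x)
    have h5 := norm_sub_le ((S ^ n) (P x)) (z ^ n • P x)
    have h6 := (S ^ n).le_opNorm (P x)
    rw [norm_smul, norm_pow] at h4 h5
    rw [sub_mul, add_mul]
    linarith
  have hp : 0 < ‖z‖ ^ n - a := sub_pos.2 ha
  have hq : 0 < b - ‖z‖ ^ n := sub_pos.2 hb
  set p := ‖z‖ ^ n - a
  set q := b - ‖z‖ ^ n
  set L := ‖S ^ n‖ + ‖z‖ ^ n
  have hL : 0 ≤ L := by positivity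
  have hC : 0 < 1 / p + (1 + L / p) / q := by positivity
  refine ⟨(1 / p + (1 + L / p) / q)⁻¹, by positivity, fun x => ?_⟩
  rw [inv_mul_le_iff₀ hC]
  set y := ‖(S ^ n) x - z ^ n • x‖
  have h1 : ‖P x‖ ≤ y / p := (le_div_iff₀' hp).2 (hA x)
  have h2 : ‖x - P x‖ ≤ (y + L * (y / p)) / q :=
    (le_div_iff₀' hq).2 ((hB x).trans (by gcongr))
  calc ‖x‖ = ‖P x + (x - P x)‖ := by rw [add_sub_cancel]
    _ ≤ y / p + (y + L * (y / p)) / q := (norm_add_le _ _).trans (add_le_add h1 h2)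
    _ = _ := by ring

theorem IsBilateralShift.isBoundedBelowAt_of_mem_annulus (hS : IsBilateralShift e ω S) {z : ℂ}
    (h1 : rMinus ω < ‖z‖) (h2 : ‖z‖ < rPlus₁ ω) : IsBoundedBelowAt S z := by
  obtain ⟨a, ha, haz⟩ := exists_between h1
  obtain ⟨b, hzb, hb⟩ := exists_between h2
  have hz : 0 ≤ ‖z‖ := norm_nonneg z
  -- One exponent n must serve both limits. It is taken positive so that nth roots can be undone and
  -- strict inequalities survive nth powers.
  obtain ⟨n, hna, hnb, hn⟩ := ((hS.tendsto_rMinus.eventually (gt_mem_nhds ha)).and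
    ((hS.tendsto_rPlus₁.eventually (lt_mem_nhds hb)).and (eventually_ge_atTop 1))).exists
  have hn0 : n ≠ 0 := by lia
  have hq : ∀ i j : ℤ, 0 ≤ beta ω i / beta ω j := fun i j =>
    div_nonneg (beta_pos hS.pos _).le (beta_pos hS.pos _).le
  have hsup0 : 0 ≤ ⨆ k : ℕ, beta ω (-(k + 1)) / beta ω (-n - (k + 1)) :=
    Real.iSup_nonneg fun k => hq _ _
  have hinf0 : 0 ≤ ⨅ k : ℕ, beta ω (n + k) / beta ω k := Real.iInf_nonneg fun k => hq _ _
  have hroot : ∀ v : ℝ, 0 ≤ v → (v ^ (1 / (n : ℝ))) ^ n = v := fun v hv => by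
    rw [one_div, Real.rpow_inv_natCast_pow hv hn0]
  have ha0 : 0 ≤ a := (Real.rpow_nonneg hsup0 _).trans hna.le
  have hna' : (⨆ k : ℕ, beta ω (-(k + 1)) / beta ω (-n - (k + 1))) ≤ a ^ n := by
    rw [← hroot _ hsup0]
    exact pow_le_pow_left₀ (Real.rpow_nonneg hsup0 _) hna.le n
  have hnb' : b ^ n ≤ ⨅ k : ℕ, beta ω (n + k) / beta ω k := by
    rw [← hroot _ hinf0]
    exact pow_le_pow_left₀ (hz.trans hzb.le) hnb.le n
  obtain ⟨C, hC⟩ := hS.bddAbove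
  refine hS.isBoundedBelowAt_of_bounds (pow_lt_pow_left₀ haz ha0 hn0)
    (pow_lt_pow_left₀ hzb hz hn0) (fun k => le_trans (le_ciSup
      (f := fun k : ℕ => beta ω (-(k + 1)) / beta ω (-n - (k + 1))) ?_ k) hna')
    (fun k => hnb'.trans (ciInf_le ?_ k))
  · refine ⟨C ^ n, ?_⟩
    rintro _ ⟨k, rfl⟩
    simp only [beta_neg_div hS.pos]
    simpa using Finset.prod_le_prod (s := Finset.range n) (fun i _ => (hS.pos _).le)
      (fun i _ => hC ⟨-((k + i : ℕ) : ℤ) - 2, rfl⟩)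
  · refine ⟨0, ?_⟩
    rintro _ ⟨k, rfl⟩
    exact hq _ _

/-! ### The radii q and r, and the rotation symmetry. -/

theorem norm_le_specRadius {z : ℂ} (h : z ∈ spectrum ℂ S) : ‖z‖ ≤ specRadius S := by
  have h1 : (‖z‖₊ : ENNReal) ≤ spectralRadius ℂ S := le_iSup₂ (α := ENNReal) z h
  have h2 : spectralRadius ℂ S ≠ ⊤ := by
    -- The index 0 gives the bound ‖S‖·‖1‖; finiteness matters because `toReal` would send ⊤ to 0.
    have := spectrum.spectralRadius_le_pow_nnnorm_pow_one_div ℂ S 0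
    refine ne_top_of_le_ne_top ?_ this
    simpa using ENNReal.mul_ne_top ENNReal.coe_ne_top ENNReal.coe_ne_top
  exact (ENNReal.toReal_mono h2 h1)

/-- The spectrum of the inverse consists of the inverses of the spectrum. On a nontrivial space its
spectral radius is attained at some z, and z⁻¹ is then a spectral point of S of least modulus. -/
theorem one_div_specRadius_inverse [Nontrivial H] (h : IsUnit S) :
    1 / specRadius (Ring.inverse S) = minModulus S := by
  obtain ⟨u, rfl⟩ := h
  rw [Ring.inverse_unit]
  obtain ⟨z, hz, hzr⟩ := spectrum.exists_nnnorm_eq_spectralRadius (↑u⁻¹ : H →L[ℂ] H)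
  have hr : specRadius (↑u⁻¹ : H →L[ℂ] H) = ‖z‖ := by
    rw [specRadius, ← hzr]; rfl
  have hinv : ∀ w : ℂ, w ∈ spectrum ℂ (↑u⁻¹ : H →L[ℂ] H) ↔ w⁻¹ ∈ spectrum ℂ (↑u : H →L[ℂ] H) :=
    fun w => by rw [← spectrum.map_inv, Set.mem_inv]
  rw [hr, one_div, ← norm_inv]
  refine le_antisymm (le_csInf ⟨_, z⁻¹, (hinv z).1 hz, rfl⟩ ?_)
    (minModulus_le_norm ((hinv z).1 hz))
  rintro _ ⟨w, hw, rfl⟩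
  have hw0 : w ≠ 0 := by
    rintro rfl
    exact (spectrum.zero_notMem ℂ u.isUnit) hw
  have h1 := norm_le_specRadius ((hinv w⁻¹).2 (by rwa [inv_inv]))
  rw [hr, norm_inv] at h1
  rw [norm_inv]
  exact inv_le_of_inv_le₀ (norm_pos_iff.2 hw0) h1

/-- The shift is unitarily equivalent to its multiples by unimodular scalars. -/
theorem IsBilateralShift.exists_rotation (hS : IsBilateralShift e ω S) {c : ℂ} (hc : ‖c‖ = 1) :
    ∃ A : H ≃ₗᵢ[ℂ] H, ∀ x, A (S x) = c • S (A x) := by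
  have hc0 : c ≠ 0 := norm_ne_zero_iff.1 (by rw [hc]; exact one_ne_zero)
  have hon : Orthonormal ℂ fun n : ℤ => c ^ n • e n := by
    constructor
    · intro n
      rw [norm_smul, norm_zpow, hc, one_zpow, one_mul, e.orthonormal.1]
    · intro i j hij
      change inner ℂ (c ^ i • e i) (c ^ j • e j) = 0
      rw [inner_smul_left, inner_smul_right, e.orthonormal.2 hij, mul_zero, mul_zero]
  have hspan : ⊤ ≤ (Submodule.span ℂ (Set.range fun n : ℤ => c ^ n • e n)).topologicalClosure := by
    rw [← e.dense_span]
    refine Submodule.topologicalClosure_mono (Submodule.span_le.2 ?_)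
    rintro _ ⟨n, rfl⟩
    have := Submodule.smul_mem _ (c ^ n)⁻¹
      (Submodule.subset_span (R := ℂ) (Set.mem_range_self (f := fun n : ℤ => c ^ n • e n) n))
    rwa [inv_smul_smul₀ (zpow_ne_zero n hc0)] at this
  let e' := HilbertBasis.mk hon hspan
  let A : H ≃ₗᵢ[ℂ] H := e.repr.trans e'.repr.symm
  have hA : ∀ n, A (e n) = c ^ n • e n := fun n => by
    classical
    simp only [A, LinearIsometryEquiv.trans_apply, e.repr_self, e'.repr_symm_single]
    simp [e']
  refine ⟨A, fun x => ?_⟩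
  have : (A : H →L[ℂ] H).comp S = c • S.comp (A : H →L[ℂ] H) :=
    clm_ext_basis (e := e) fun n => by
      simp [hA, hS.apply_basis, smul_smul, zpow_add₀ hc0]
      rw [mul_comm, smul_comm]
  exact congrArg (fun B : H →L[ℂ] H => B x) this

theorem IsBilateralShift.mem_sigmaBeta_of_norm_eq (hS : IsBilateralShift e ω S) {z w : ℂ}
    (hz : z ∈ sigmaBeta S) (h : ‖z‖ = ‖w‖) : w ∈ sigmaBeta S := by
  rcases eq_or_ne z 0 with rfl | hz0
  · rw [norm_zero, eq_comm, norm_eq_zero] at h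
    rwa [h]
  · have hzn : ‖z‖ ≠ 0 := norm_ne_zero_iff.2 hz0
    have hw0 : w ≠ 0 := norm_ne_zero_iff.1 (h ▸ hzn)
    -- The unimodular scalar w / z carries z to w.
    obtain ⟨A, hA⟩ := hS.exists_rotation (c := w / z) (by rw [norm_div, ← h, div_self hzn])
    intro hw
    refine hz (HasBishopAt.rotate (div_ne_zero hw0 hz0) A hA ?_)
    rwa [div_mul_cancel₀ _ hz0]

theorem IsBilateralShift.inter_circle (hS : IsBilateralShift e ω S) (ρ : ℝ) :
    sigmaBeta S ∩ {z | ‖z‖ = ρ} = ∅ ∨ sigmaBeta S ∩ {z | ‖z‖ = ρ} = {z | ‖z‖ = ρ} := by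
  rcases Set.eq_empty_or_nonempty (sigmaBeta S ∩ {z | ‖z‖ = ρ}) with h | ⟨z, hz, hzρ⟩
  · exact Or.inl h
  · exact Or.inr (Set.inter_eq_right.2 fun w hw =>
      hS.mem_sigmaBeta_of_norm_eq hz (hzρ.trans (Eq.symm hw)))

theorem IsBilateralShift.isBoundedBelowAt (hS : IsBilateralShift e ω S)
    (h1 : minModulus S = rMinus ω) (h2 : rPlus₁ ω = specRadius S) {z : ℂ}
    (hq : ‖z‖ ≠ minModulus S) (hr : ‖z‖ ≠ specRadius S) : IsBoundedBelowAt S z := by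
  rcases hq.lt_or_gt with hq | hq
  · exact isBoundedBelowAt_of_notMem_spectrum fun h => (minModulus_le_norm h).not_gt hq
  rcases hr.lt_or_gt with hr | hr
  · exact hS.isBoundedBelowAt_of_mem_annulus (h1 ▸ hq) (h2 ▸ hr)
  · exact isBoundedBelowAt_of_notMem_spectrum fun h => (norm_le_specRadius h).not_gt hr

theorem IsBilateralShift.sigmaBeta_subset (hS : IsBilateralShift e ω S)
    (h1 : minModulus S = rMinus ω) (h2 : rPlus₁ ω = specRadius S) :
    sigmaBeta S ⊆ {z | ‖z‖ = minModulus S} ∪ {z | ‖z‖ = specRadius S} := by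
  intro z hz
  by_contra hne
  rw [Set.mem_union, not_or] at hne
  have hopen : IsOpen {w : ℂ | ‖w‖ ≠ minModulus S ∧ ‖w‖ ≠ specRadius S} :=
    (isOpen_ne_fun continuous_norm continuous_const).inter
      (isOpen_ne_fun continuous_norm continuous_const)
  obtain ⟨ρ, hρ, hsub⟩ := Metric.isOpen_iff.1 hopen z hne
  exact hz (hasBishopAt_of_punctured hρ fun w hw _ =>
    hS.isBoundedBelowAt h1 h2 (hsub hw).1 (hsub hw).2)

/-- The disc of radius r punctured at 0 meets neither circle, so the punctured criterion applies at
0. -/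
theorem IsBilateralShift.zero_notMem_sigmaBeta (hS : IsBilateralShift e ω S)
    (h1 : minModulus S = rMinus ω) (h2 : rPlus₁ ω = specRadius S) (hq : minModulus S = 0)
    (hr : specRadius S ≠ 0) : (0 : ℂ) ∉ sigmaBeta S := by
  have hr' : 0 < specRadius S := lt_of_le_of_ne ENNReal.toReal_nonneg hr.symm
  refine fun h => h (hasBishopAt_of_punctured hr' fun w hw hw0 => ?_)
  rw [mem_ball_zero_iff] at hw
  exact hS.isBoundedBelowAt h1 h2 (hq ▸ norm_ne_zero_iff.2 hw0) hw.ne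

end Shift

end WeightedShift

open WeightedShift in
theorem mainTheorem7 {H : Type*} [NormedAddCommGroup H] [InnerProductSpace ℂ H] [CompleteSpace H]
    (e : HilbertBasis ℤ ℂ H) (ω : ℤ → ℝ) (S : H →L[ℂ] H) (hS : IsBilateralShift e ω S)
    (hqs1 : minModulus S = rMinus₁ ω ∧ rMinus₁ ω = rMinus₂ ω ∧ rMinus₂ ω = rMinus₃ ω ∧
      rMinus₃ ω = rMinus ω)
    (hqs2 : rPlus₁ ω = rPlus₂ ω ∧ rPlus₂ ω = rPlus₃ ω ∧ rPlus₃ ω = rPlus ω ∧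
      rPlus ω = specRadius S) :
    (¬ IsUnit S → HasBishop S ∨ sigmaBeta S = {z : ℂ | ‖z‖ = specRadius S}) ∧
    (IsUnit S → HasBishop S ∨
      sigmaBeta S = {z : ℂ | ‖z‖ = 1 / specRadius (Ring.inverse S)} ∨
      sigmaBeta S = {z : ℂ | ‖z‖ = specRadius S} ∨
      sigmaBeta S = {z : ℂ | ‖z‖ = 1 / specRadius (Ring.inverse S)} ∪
        {z : ℂ | ‖z‖ = specRadius S}) := by
  have hq : minModulus S = rMinus ω :=
    hqs1.1.trans (hqs1.2.1.trans (hqs1.2.2.1.trans hqs1.2.2.2))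
  have hr : rPlus₁ ω = specRadius S :=
    hqs2.1.trans (hqs2.2.1.trans (hqs2.2.2.1.trans hqs2.2.2.2))
  have hsub := hS.sigmaBeta_subset hq hr
  constructor
  · intro hu
    have hq0 := minModulus_eq_zero hu
    have hsub' : sigmaBeta S ⊆ {z | ‖z‖ = specRadius S} := by
      intro z hz
      rcases hsub hz with h | h
      · rw [Set.mem_ofPred_eq, hq0, norm_eq_zero] at h
        subst h
        -- If 0 is not on the outer circle then r ≠ 0, which is what excludes 0 from σ_β(S).
        by_contra hne
        exact hS.zero_notMem_sigmaBeta hq hr hq0 (fun h0 => hne (by simp [h0])) hz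
      · exact h
    have h := hS.inter_circle (specRadius S)
    rw [Set.inter_eq_left.2 hsub'] at h
    exact h.imp_left hasBishop_of_sigmaBeta_eq_empty
  · intro hu
    have := nontrivial_of_hilbertBasis e
    rw [one_div_specRadius_inverse hu]
    -- σ_β(S) is the union of its traces on the two circles, each empty or full; the four
    -- combinations are the four alternatives.
    have hdecomp := (Set.inter_eq_left.2 hsub).symm
    rw [Set.inter_union_distrib_left] at hdecomp
    rcases hS.inter_circle (minModulus S) with h1 | h1 <;>
      rcases hS.inter_circle (specRadius S) with h2 | h2 <;> rw [h1, h2] at hdecomp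
    · exact Or.inl (hasBishop_of_sigmaBeta_eq_empty (by simpa using hdecomp))
    · exact Or.inr (Or.inr (Or.inl (by simpa using hdecomp)))
    · exact Or.inr (Or.inl (by simpa using hdecomp))
    · exact Or.inr (Or.inr (Or.inr hdecomp))
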